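/- Let $r\ge 0$ be an integer and let $z,\omega_1,\dots,\omega_r$ lie in the upper half-plane $\mathfrak H=\{w\in\mathbf C : \operatorname{Im} w>0\}$; write $\boldsymbol\omega=(\omega_1,\dots,\omega_r)$. Powers $w^s$ are taken with $-\pi<\arg w\le\pi$. For $\operatorname{Re}(s)>r+1$, the Barnes zeta function is $$\zeta_{r+1}(s,x\mid \omega_0,\boldsymbol\omega)=\sum_{m_0,\dots,m_r=0}^{\infty}\frac{1}{(x+m_0\omega_0+m_1\omega_1+\cdots+m_r\omega_r)^s},$$ and the bilateral zeta function (with $\omega_0=e^{\pi i}=-1$) is $$\xi_{r+1}(s,z\mid e^{\pi i};\boldsymbol\omega)=\zeta_{r+1}(s,z+e^{\pi i}\mid e^{\pi i},\boldsymbol\omega)+\zeta_{r+1}(s,z\mid -e^{\pi i},\boldsymbol\omega).$$ Both series on the right converge absolutely for $\operatorname{Re}(s)>r+1$, and $s\mapsto\xi_{r+1}(s,z\mid e^{\pi i};\boldsymbol\omega)$ continues analytically (uniquely) to an entire function, denoted by the same symbol. For every $s\in\mathbf C$, $$\xi_{r+1}(s,z\mid e^{\pi i};\boldsymbol\omega)=\frac{e^{-\frac{\pi}{2}is}(2\pi)^s}{\Gamma(s)}\sum_{n=1}^{\infty}\frac{n^{s-1}e^{2\pi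 i n z}}{(1-e^{2\pi i n\omega_1})\cdots(1-e^{2\pi i n\omega_r})},$$ where the series converges absolutely and $1/\Gamma(s)$ is read as $0$ at $s=0,-1,-2,\dots$. -/

import Mathlib

noncomputable section

/-- The general term `1 / (z + m₁ω₁ + ⋯ + mₙωₙ)^s` of the Barnes multiple zeta series, with the
principal power, i.e. the argument in `(-π, π]`. -/
def barnesTerm {n : ℕ} (s z : ℂ) (ω : Fin n → ℂ) (m : Fin n → ℕ) : ℂ :=
  1 / (z + ∑ j, (m j : ℂ) * ω j) ^ s

/-- The `n`-ple Barnes zeta function `ζₙ(s, z | ω)` given by its series, which is meant for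
`Re s > n`, the half-plane of absolute convergence. -/
def barnesZeta {n : ℕ} (s z : ℂ) (ω : Fin n → ℂ) : ℂ :=
  ∑' m : Fin n → ℕ, barnesTerm s z ω m

/-- The sum `ζ_{r+1}(s, z + ω₀ | ω₀, ω) + ζ_{r+1}(s, z | -ω₀, ω)` of two Barnes zeta functions,
which defines the bilateral zeta function for `Re s > r + 1`. -/
def bilateralZetaSum {r : ℕ} (s z ω₀ : ℂ) (ω : Fin r → ℂ) : ℂ :=
  barnesZeta s (z + ω₀) (Fin.cons ω₀ ω : Fin (r + 1) → ℂ) +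
    barnesZeta s z (Fin.cons (-ω₀) ω : Fin (r + 1) → ℂ)

open Classical in
/-- The entire function that agrees with `f` on `{s | σ < Re s}`. There is at most one, by the
identity theorem; if there is none, the value is `f` itself. -/
def entireContinuation (σ : ℝ) (f : ℂ → ℂ) : ℂ → ℂ :=
  if h : ∃ F : ℂ → ℂ, Differentiable ℂ F ∧ ∀ s : ℂ, σ < s.re → F s = f s then h.choose else f

/-- The bilateral `(r+1)`-ple zeta function `ξ_{r+1}(s, z | ω₀; ω)` on the whole `s`-plane: the
analytic continuation of the sum of two Barnes zeta functions from `Re s > r + 1`. -/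
def bilateralZeta {r : ℕ} (s z ω₀ : ℂ) (ω : Fin r → ℂ) : ℂ :=
  entireContinuation ((r : ℝ) + 1) (fun t => bilateralZetaSum t z ω₀ ω) s

/-- The general term `n^(s-1) e^(2πinz) / ∏ⱼ (1 - e^(2πinωⱼ))` of the Fourier series. -/
def fourierTerm {r : ℕ} (s z : ℂ) (ω : Fin r → ℂ) (n : ℕ+) : ℂ :=
  ((n : ℕ) : ℂ) ^ (s - 1) * Complex.exp (2 * Real.pi * Complex.I * ((n : ℕ) : ℂ) * z) /
    ∏ j, (1 - Complex.exp (2 * Real.pi * Complex.I * ((n : ℕ) : ℂ) * ω j))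

end

/-! For fixed `m`, the two Barnes series glue into one sum over all integers: with w = z + ∑ mⱼωⱼ,
the parameter 1 gives w + k for k ≥ 0, and the parameter -1 with its shift gives k ≤ -1. Lipschitz's
formula turns ∑ₖ (w + k)^(-s) into a constant times ∑ n^(s-1) e^(2πinw). It is Poisson summation for
t ↦ t^(s-1) e^(2πiwt) on t > 0, whose Fourier transform is a Gamma integral with complex rate.
Summing over `m` and exchanging sums, the geometric series in e^(2πinωⱼ) produce the denominators.

This proves the formula for Re s > r + 1. Its right side is entire, because the series decays like
e^(-2πn Im z) locally uniformly in `s` and 1/Γ is entire, so it is the continuation. -/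

section

open Filter Topology MeasureTheory Set FourierTransform

/-! ### Absolute convergence of the Barnes series -/

/-- The product of finitely many absolutely convergent series, expanded as a multiple series. -/
theorem summable_norm_and_hasSum_prod_fin {n : ℕ} {α R : Type*} [NormedField R] [CompleteSpace R]
    (f : Fin n → α → R) (hf : ∀ j, Summable fun k => ‖f j k‖) :
    (Summable fun m : Fin n → α => ‖∏ j, f j (m j)‖) ∧
      HasSum (fun m : Fin n → α => ∏ j, f j (m j)) (∏ j, ∑' k, f j k) := by
  induction n with
  | zero => exact ⟨Summable.of_finite, by simp⟩
  | succ n ih =>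
    obtain ⟨ih₁, ih₂⟩ := ih (fun j => f j.succ) fun j => hf j.succ
    have h₁ := (hf 0).mul_norm ih₁
    have h₂ := (hf 0).of_norm.hasSum.mul ih₂ h₁.of_norm
    constructor
    · rw [← (Fin.consEquiv fun _ : Fin (n + 1) => α).summable_iff]
      refine h₁.congr fun p => ?_
      simp [Fin.consEquiv, Fin.prod_univ_succ]
    · rw [← (Fin.consEquiv fun _ : Fin (n + 1) => α).hasSum_iff, Fin.prod_univ_succ]
      rw [show (fun m : Fin (n + 1) → α => ∏ j, f j (m j)) ∘ (Fin.consEquiv fun _ => α) =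
        fun p => f 0 p.1 * ∏ j, f j.succ (p.2 j) from
          funext fun p => by simp [Fin.consEquiv, Fin.prod_univ_succ]]
      exact h₂

/-- The Barnes multiple zeta series converges absolutely for `n < Re s` when the parameters lie in
a common open half-plane bounded by a line through the origin. -/
theorem summable_barnesTerm_of_re_pos {n : ℕ} {s x u : ℂ} {ω : Fin n → ℂ} (hs : (n : ℝ) < s.re)
    (hx : 0 < (u * x).re) (hω : ∀ j, 0 < (u * ω j).re) : Summable (barnesTerm s x ω) := by
  rcases Nat.eq_zero_or_pos n with rfl | hn
  · exact Summable.of_finite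
  have hn' : (0 : ℝ) < n := by exact_mod_cast hn
  obtain ⟨c, hcpos, hcx, hcω⟩ : ∃ c : ℝ, 0 < c ∧ c ≤ (u * x).re ∧ ∀ j, c ≤ (u * ω j).re := by
    have h : ∀ a : ℝ, 0 < a → ∀ᶠ c in 𝓝[>] (0 : ℝ), c ≤ a := fun a ha =>
      nhdsWithin_le_nhds (eventually_le_nhds ha)
    obtain ⟨c, hc⟩ := ((h _ hx).and ((eventually_all.2 fun j => h _ (hω j)).and
      self_mem_nhdsWithin)).exists
    exact ⟨c, hc.2.2, hc.1, hc.2.1⟩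
  have hu : 0 < ‖u‖ := norm_pos_iff.2 (by rintro rfl; simp at hx)
  set d : ℝ := c / ‖u‖
  have hd : 0 < d := div_pos hcpos hu
  -- After rotation by `u` all real parts are at least `c`, so the norm grows linearly in each `m j`
  -- separately.
  have hlow : ∀ (m : Fin n → ℕ) j, d * ((m j : ℝ) + 1) ≤ ‖x + ∑ j, (m j : ℂ) * ω j‖ := by
    intro m j
    have h₁ : (u * (x + ∑ j, (m j : ℂ) * ω j)).re
        = (u * x).re + ∑ j, (m j : ℝ) * (u * ω j).re := by
      rw [mul_add, Complex.add_re, Finset.mul_sum, Complex.re_sum]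
      congr 1
      refine Finset.sum_congr rfl fun j _ => ?_
      rw [mul_left_comm, ← Complex.ofReal_natCast, Complex.re_ofReal_mul]
    have h₂ : (m j : ℝ) * c ≤ ∑ j, (m j : ℝ) * (u * ω j).re :=
      (mul_le_mul_of_nonneg_left (hcω j) (Nat.cast_nonneg _)).trans
        (Finset.single_le_sum (f := fun j => (m j : ℝ) * (u * ω j).re)
          (fun i _ => mul_nonneg (Nat.cast_nonneg _) (hω i).le) (Finset.mem_univ j))
    have h₃ := (Complex.re_le_norm (u * (x + ∑ j, (m j : ℂ) * ω j)))
    rw [norm_mul] at h₃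
    rw [div_mul_eq_mul_div, div_le_iff₀ hu]
    nlinarith
  -- Splitting the exponent evenly over the `n` coordinates bounds the term by a product of
  -- one-variable series, each of exponent `e > 1`.
  set e : ℝ := s.re / n
  have he : 1 < e := (one_lt_div hn').2 hs
  have hsum : Summable fun k : ℕ => ‖(d * ((k : ℝ) + 1)) ^ (-e)‖ := by
    have h := ((Real.summable_nat_rpow.2 (by linarith : -e < -1)).comp_injective
      (add_left_injective 1)).mul_left (d ^ (-e))
    refine h.congr fun k => ?_
    rw [Real.norm_of_nonneg (by positivity), Real.mul_rpow hd.le (by positivity)]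
    simp
  have hprod := (summable_norm_and_hasSum_prod_fin
    (fun (_ : Fin n) (k : ℕ) => (d * ((k : ℝ) + 1)) ^ (-e)) fun _ => hsum).1
  refine Summable.of_norm_bounded (hprod.mul_left (Real.exp (Real.pi * |s.im|))) fun m => ?_
  set w := x + ∑ j, (m j : ℂ) * ω j
  have hw : 0 < ‖w‖ := lt_of_lt_of_le (by positivity) (hlow m ⟨0, hn⟩)
  have h₁ : ‖barnesTerm s x ω m‖ ≤ Real.exp (Real.pi * |s.im|) * ‖w‖ ^ (-s.re) := by
    rw [barnesTerm, norm_div, norm_one, Complex.norm_cpow_of_ne_zero (norm_pos_iff.1 hw),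
      one_div_div, div_eq_mul_inv, ← Real.rpow_neg hw.le]
    refine mul_le_mul_of_nonneg_right (Real.exp_le_exp.2 ?_) (by positivity)
    calc w.arg * s.im ≤ |w.arg * s.im| := le_abs_self _
      _ = |w.arg| * |s.im| := abs_mul _ _
      _ ≤ _ := by gcongr; exact Complex.abs_arg_le_pi w
  refine h₁.trans ?_
  gcongr
  rw [norm_prod]
  have h₂ : ‖w‖ ^ (-s.re) = ∏ _j : Fin n, ‖w‖ ^ (-e) := by
    rw [Finset.prod_const, Finset.card_univ, Fintype.card_fin, ← Real.rpow_mul_natCast hw.le]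
    congr 1
    simp only [e]
    field_simp
  rw [h₂]
  refine Finset.prod_le_prod (fun _ _ => by positivity) fun j _ => ?_
  rw [Real.norm_of_nonneg (by positivity)]
  exact Real.rpow_le_rpow_of_nonpos (by positivity) (hlow m j) (by linarith)

/-- The Barnes series with parameters in the upper half-plane and one further nonzero real
parameter converges absolutely. -/
theorem summable_barnesTerm_cons_ofReal {r : ℕ} {s x : ℂ} {a : ℝ} (ha : a ≠ 0) {ω : Fin r → ℂ}
    (hs : (r : ℝ) + 1 < s.re) (hx : 0 < x.im) (hω : ∀ j, 0 < (ω j).im) :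
    Summable (barnesTerm s x (Fin.cons (a : ℂ) ω : Fin (r + 1) → ℂ)) := by
  -- Multiplication by -i sends the upper half-plane to the right one but the real `a` to its
  -- boundary; the small tilt `ε * a` makes the latter's real part `ε * a²`, still keeping the
  -- finitely many others positive.
  have h : ∀ v : ℂ, 0 < v.im → ∀ᶠ ε in 𝓝[>] (0 : ℝ), 0 < v.im + ε * a * v.re := fun v hv => by
    have hc : ContinuousAt (fun ε : ℝ => v.im + ε * a * v.re) 0 := by fun_prop
    exact nhdsWithin_le_nhds (hc.eventually (lt_mem_nhds (by simpa using hv)))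
  obtain ⟨ε, hεx, hεω, hε⟩ := ((h _ hx).and ((eventually_all.2 fun j => h _ (hω j)).and
    self_mem_nhdsWithin)).exists
  have hre : ∀ v : ℂ, ((((ε * a : ℝ) : ℂ) - Complex.I) * v).re = v.im + ε * a * v.re := fun v => by
    simp [sub_mul]; ring
  refine summable_barnesTerm_of_re_pos (u := ((ε * a : ℝ) : ℂ) - Complex.I)
    (by push_cast; exact hs) (by rwa [hre]) fun j => ?_
  refine Fin.cases ?_ (fun j => ?_) j
  · rw [hre, Fin.cons_zero, Complex.ofReal_im, Complex.ofReal_re, zero_add, mul_assoc]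
    exact mul_pos hε (mul_self_pos.2 ha)
  · rw [hre, Fin.cons_succ]
    exact hεω j

/-! ### The Gamma integral with complex rate -/

theorem norm_cpow_mul_exp_neg_mul {a r : ℂ} {t : ℝ} (ht : 0 < t) :
    ‖(t : ℂ) ^ a * Complex.exp (-(r * t))‖ = t ^ a.re * Real.exp (-r.re * t) := by
  rw [norm_mul, Complex.norm_cpow_eq_rpow_re_of_pos ht, Complex.norm_exp]
  simp

theorem continuousOn_cpow_mul_exp_neg_mul (a r : ℂ) :
    ContinuousOn (fun t : ℝ => (t : ℂ) ^ a * Complex.exp (-(r * t))) (Ioi 0) := by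
  refine ContinuousOn.mul (fun t ht => ?_) (by fun_prop)
  exact (Complex.continuousAt_ofReal_cpow_const t a (Or.inr (ne_of_gt ht))).continuousWithinAt

theorem integrableOn_cpow_mul_exp_neg_mul {a r : ℂ} (ha : -1 < a.re) (hr : 0 < r.re) :
    IntegrableOn (fun t : ℝ => (t : ℂ) ^ a * Complex.exp (-(r * t))) (Ioi 0) := by
  have h := integrableOn_rpow_mul_exp_neg_mul_rpow ha one_pos hr
  refine h.mono' ((continuousOn_cpow_mul_exp_neg_mul a r).aestronglyMeasurable
    measurableSet_Ioi) ?_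
  filter_upwards [ae_restrict_mem measurableSet_Ioi] with t ht
  rw [norm_cpow_mul_exp_neg_mul ht, Real.rpow_one]

/-- On the ball of radius `r.re / 2` the rate keeps real part above `r.re / 2`, which gives an
integrable majorant for the derivative. -/
theorem hasDerivAt_integral_cpow_mul_exp_neg_mul {a r : ℂ} (ha : -1 < a.re) (hr : 0 < r.re) :
    HasDerivAt (fun r : ℂ => ∫ t in Ioi (0 : ℝ), (t : ℂ) ^ a * Complex.exp (-(r * t)))
      (∫ t in Ioi (0 : ℝ), (t : ℂ) ^ a * (Complex.exp (-(r * t)) * (-(t : ℂ)))) r := by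
  have hb := integrableOn_rpow_mul_exp_neg_mul_rpow (s := a.re + 1) (by linarith) one_pos
    (half_pos hr)
  refine (hasDerivAt_integral_of_dominated_loc_of_deriv_le
    (F := fun (r : ℂ) (t : ℝ) => (t : ℂ) ^ a * Complex.exp (-(r * t)))
    (F' := fun (r : ℂ) (t : ℝ) => (t : ℂ) ^ a * (Complex.exp (-(r * t)) * (-(t : ℂ))))
    (Metric.ball_mem_nhds r (half_pos hr))
    (Eventually.of_forall fun q => (continuousOn_cpow_mul_exp_neg_mul a q).aestronglyMeasurable
      measurableSet_Ioi) (integrableOn_cpow_mul_exp_neg_mul ha hr) ?_ ?_ hb ?_).2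
  · simp_rw [← mul_assoc]
    exact ((continuousOn_cpow_mul_exp_neg_mul a r).mul (by fun_prop)).aestronglyMeasurable
      measurableSet_Ioi
  · filter_upwards [ae_restrict_mem measurableSet_Ioi] with t ht q hq
    have ht' : 0 < t := ht
    rw [← mul_assoc, norm_mul, norm_cpow_mul_exp_neg_mul ht, norm_neg, Complex.norm_real,
      Real.norm_of_nonneg ht'.le, Real.rpow_add_one ht'.ne', Real.rpow_one, mul_right_comm]
    gcongr
    have h₁ := (Complex.abs_re_le_norm (q - r)).trans_lt (mem_ball_iff_norm.1 hq)
    rw [Complex.sub_re, abs_lt] at h₁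
    linarith [h₁.1]
  · refine Eventually.of_forall fun t q _ => ?_
    have h := (((hasDerivAt_id q).mul_const (t : ℂ)).neg.cexp).const_mul ((t : ℂ) ^ a)
    simpa using h

/-- The Gamma integral `∫ t^(a-1) e^(-rt) dt = Γ(a) / r^a` for a complex rate `r`. -/
theorem integral_cpow_mul_exp_neg_mul_Ioi_of_re_pos {a r : ℂ} (ha : 0 < a.re) (hr : 0 < r.re) :
    ∫ t in Ioi (0 : ℝ), (t : ℂ) ^ (a - 1) * Complex.exp (-(r * t))
      = (1 / r) ^ a * Complex.Gamma a := by
  have hU : IsOpen {r : ℂ | 0 < r.re} := isOpen_lt continuous_const Complex.continuous_re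
  have hf : AnalyticOnNhd ℂ
      (fun r : ℂ => ∫ t in Ioi (0 : ℝ), (t : ℂ) ^ (a - 1) * Complex.exp (-(r * t)))
      {r : ℂ | 0 < r.re} :=
    DifferentiableOn.analyticOnNhd (fun q hq => (hasDerivAt_integral_cpow_mul_exp_neg_mul
      (by simpa using ha) hq).differentiableAt.differentiableWithinAt) hU
  have hg : AnalyticOnNhd ℂ (fun r : ℂ => (1 / r) ^ a * Complex.Gamma a) {r : ℂ | 0 < r.re} := by
    refine DifferentiableOn.analyticOnNhd (fun q hq => ?_) hU
    have hq' : 0 < q.re := hq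
    have hq₀ : q ≠ 0 := by rintro rfl; simp at hq'
    refine DifferentiableAt.differentiableWithinAt (DifferentiableAt.mul_const ?_ _)
    refine DifferentiableAt.cpow_const (by fun_prop (disch := assumption)) ?_
    rw [Complex.mem_slitPlane_iff]
    left
    rw [one_div, Complex.inv_re]
    exact div_pos hq' (Complex.normSq_pos.2 hq₀)
  -- Identity theorem: the formula is known for positive real rates, and the points 1 + 1/(n+1)
  -- accumulate at 1.
  refine hf.eqOn_of_preconnected_of_frequently_eq hg
    (convex_halfSpace_re_gt 0).isPreconnected (z₀ := 1) (by simp) ?_ hr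
  have hlim : Tendsto (fun n : ℕ => ((1 + 1 / ((n : ℝ) + 1) : ℝ) : ℂ)) atTop (𝓝[≠] 1) := by
    refine tendsto_nhdsWithin_iff.2 ⟨?_, Eventually.of_forall fun n => ?_⟩
    · have h := tendsto_one_div_add_atTop_nhds_zero_nat (𝕜 := ℝ)
      have h' := (Complex.continuous_ofReal.tendsto _).comp (h.const_add 1)
      simpa [Function.comp_def] using h'
    · have : (1 / ((n : ℝ) + 1)) ≠ 0 := by positivity
      intro h
      apply this
      have h' : (1 + 1 / ((n : ℝ) + 1) : ℝ) = 1 := Complex.ofReal_eq_one.1 h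
      linarith
  refine hlim.frequently (Frequently.of_forall fun n => ?_)
  exact Complex.integral_cpow_mul_exp_neg_mul_Ioi ha (by positivity)

/-! ### Lipschitz's formula -/

/-- Principal powers split here without a branch jump: for `w` in the upper half-plane, log(-iw) =
log w - iπ/2. -/
theorem one_div_neg_two_pi_I_mul_cpow {w : ℂ} (hw : 0 < w.im) (s : ℂ) :
    Complex.exp (-(Real.pi / 2) * Complex.I * s) * (2 * Real.pi : ℂ) ^ s *
      (1 / (-(2 * Real.pi * Complex.I * w))) ^ s = 1 / w ^ s := by
  have hw₀ : w ≠ 0 := by rintro rfl; simp at hw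
  have hπ : (2 * Real.pi : ℂ) = ((2 * Real.pi : ℝ) : ℂ) := by push_cast; rfl
  have harg := Complex.arg_mem_Ioc w
  have h₀ : 0 ≤ w.arg := Complex.arg_nonneg_iff.2 hw.le
  have hv : (-(2 * Real.pi * Complex.I * w)) = ((2 * Real.pi : ℝ) : ℂ) * (-Complex.I * w) := by
    push_cast; ring
  have hne : -Complex.I * w ≠ 0 := mul_ne_zero (neg_ne_zero.2 Complex.I_ne_zero) hw₀
  have hlog : Complex.log (-Complex.I * w) = -(Real.pi / 2) * Complex.I + Complex.log w := by
    rw [Complex.log_mul (neg_ne_zero.2 Complex.I_ne_zero) hw₀ ?_, Complex.log_neg_I]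
    rw [Complex.arg_neg_I]
    constructor <;> linarith [harg.1, harg.2, Real.pi_pos]
  have hinv : (1 / (-(2 * Real.pi * Complex.I * w))) ^ s
      = ((-(2 * Real.pi * Complex.I * w)) ^ s)⁻¹ := by
    rw [one_div, Complex.inv_cpow]
    intro h
    have h' := (Complex.arg_eq_pi_iff.1 h).1
    simp at h'
    nlinarith [Real.pi_pos]
  rw [hinv, hv, Complex.cpow_def_of_ne_zero (mul_ne_zero (by simp [Real.pi_ne_zero]) hne),
    Complex.log_ofReal_mul (by positivity) hne, hlog, hπ,
    Complex.cpow_def_of_ne_zero (by simp [Real.pi_ne_zero]), Complex.cpow_def_of_ne_zero hw₀,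
    ← Complex.ofReal_log (by positivity), ← Complex.exp_neg, one_div, ← Complex.exp_neg,
    ← Complex.exp_add, ← Complex.exp_add]
  congr 1
  ring

theorem summable_int_one_div_add_cpow {w s : ℂ} (hw : 0 < w.im) (hs : 1 < s.re) :
    Summable fun k : ℤ => 1 / (w + k) ^ s := by
  have h : ∀ (a : ℝ) (x : ℂ), a ≠ 0 → 0 < x.im → Summable fun k : ℕ => 1 / (x + k * a) ^ s := by
    intro a x ha hx
    have h := summable_barnesTerm_cons_ofReal (r := 0) (ω := Fin.elim0) ha
      (by simpa using hs) hx (fun j => j.elim0)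
    rw [← (Equiv.funUnique (Fin 1) ℕ).symm.summable_iff] at h
    refine h.congr fun k => ?_
    simp [barnesTerm]
  refine Summable.of_nat_of_neg_add_one ?_ ?_
  · simpa using h 1 w one_ne_zero hw
  · refine (h (-1) (w - 1) (by norm_num) (by simpa using hw)).congr fun k => ?_
    push_cast
    congr 2
    ring

/-- **Lipschitz's formula** with a complex exponent. -/
theorem tsum_int_one_div_add_cpow {w s : ℂ} (hw : 0 < w.im) (hs : 1 < s.re) :
    ∑' k : ℤ, 1 / (w + k) ^ s =
      Complex.exp (-(Real.pi / 2) * Complex.I * s) * (2 * Real.pi : ℂ) ^ s / Complex.Gamma s *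
        ∑' n : ℕ+, ((n : ℕ) : ℂ) ^ (s - 1) *
          Complex.exp (2 * Real.pi * Complex.I * ((n : ℕ) : ℂ) * w) := by
  have hs₁ : 0 < (s - 1).re := by simpa using hs
  have hs₀ : s - 1 ≠ 0 := by rintro h; simp [h] at hs₁
  set ρ : ℂ := -(2 * Real.pi * Complex.I * w)
  have hρ : ρ.re = 2 * Real.pi * w.im := by simp [ρ]
  have hρpos : 0 < ρ.re := by rw [hρ]; have := Real.pi_pos; positivity
  -- Truncating by `max t 0` gives a function continuous on all of ℝ, since 0^(s-1) = 0 when Re s >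
  -- 1.
  set g : ℝ → ℂ := fun t => ((max t 0 : ℝ) : ℂ) ^ (s - 1) * Complex.exp (-(ρ * t))
  have hg₀ : ∀ t ≤ 0, g t = 0 := fun t ht => by
    simp [g, max_eq_right ht, Complex.zero_cpow hs₀]
  have hgpos : ∀ t, 0 < t → g t = (t : ℂ) ^ (s - 1) * Complex.exp (-(ρ * t)) := fun t ht => by
    simp [g, max_eq_left ht.le]
  have hcont : Continuous g :=
    ((Complex.continuous_ofReal_cpow_const hs₁).comp (by fun_prop)).mul (by fun_prop)
  have hF : ∀ n : ℤ, 𝓕 g n = Complex.Gamma s * (1 / (-(2 * Real.pi * Complex.I * (w - n)))) ^ s := by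
    intro n
    have hr : 0 < (-(2 * Real.pi * Complex.I * (w - n)) : ℂ).re := by
      simpa [mul_assoc] using mul_pos Real.pi_pos hw
    rw [Real.fourier_real_eq_integral_exp_smul, mul_comm (Complex.Gamma s),
      ← integral_cpow_mul_exp_neg_mul_Ioi_of_re_pos (by linarith) hr,
      ← setIntegral_eq_integral_of_forall_compl_eq_zero (s := Ioi 0)
        (fun t ht => by rw [hg₀ t (not_lt.1 ht), smul_zero])]
    refine setIntegral_congr_fun measurableSet_Ioi fun t ht => ?_
    rw [hgpos t ht, smul_eq_mul, mul_left_comm, ← Complex.exp_add]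
    congr 2
    simp only [ρ]
    push_cast
    ring
  have hpow : ∀ n : ℤ, Complex.exp (-(Real.pi / 2) * Complex.I * s) * (2 * Real.pi : ℂ) ^ s *
      (1 / (-(2 * Real.pi * Complex.I * (w - n)))) ^ s = 1 / (w + (-n : ℤ)) ^ s := fun n => by
    rw [one_div_neg_two_pi_I_mul_cpow (by simpa using hw)]
    push_cast
    rw [sub_eq_add_neg]
  set C : ℂ := Complex.exp (-(Real.pi / 2) * Complex.I * s) * (2 * Real.pi : ℂ) ^ s
  have hC : C ≠ 0 := mul_ne_zero (Complex.exp_ne_zero _)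
    (by rw [Complex.cpow_ne_zero_iff]; left; simp [Real.pi_ne_zero])
  have hΓ : Complex.Gamma s ≠ 0 := Complex.Gamma_ne_zero_of_re_pos (by linarith)
  have hF' : ∀ n : ℤ, 𝓕 g n = Complex.Gamma s / C * (1 / (w + (-n : ℤ)) ^ s) := fun n => by
    rw [hF, ← hpow]
    field_simp
  have hsum := summable_int_one_div_add_cpow hw hs
  have hsum' : Summable fun n : ℤ => 𝓕 g n := by
    refine ((((Equiv.neg ℤ).summable_iff.2 hsum)).mul_left (Complex.Gamma s / C)).congr fun n => ?_
    rw [hF' n]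
    rfl
  -- Any exponent below -1 would serve for Poisson summation.
  have hO : g =O[cocompact ℝ] fun x : ℝ => |x| ^ (-2 : ℝ) := by
    rw [cocompact_eq_atBot_atTop, Asymptotics.isBigO_sup]
    constructor
    · refine (Asymptotics.isBigO_zero _ _).congr' ?_ EventuallyEq.rfl
      filter_upwards [eventually_le_atBot 0] with t ht
      exact (hg₀ t ht).symm
    · have h := tendsto_rpow_mul_exp_neg_mul_atTop_nhds_zero ((s - 1).re + 2) ρ.re hρpos
      refine Asymptotics.IsBigO.of_bound 1 ?_
      filter_upwards [h.eventually (gt_mem_nhds one_pos), eventually_gt_atTop 0] with t ht htpos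
      rw [hgpos t htpos, norm_cpow_mul_exp_neg_mul htpos, one_mul, abs_of_pos htpos,
        Real.norm_of_nonneg (by positivity), Real.rpow_neg htpos.le,
        le_inv_comm₀ (by positivity) (by positivity)]
      rw [Real.rpow_add htpos, mul_right_comm] at ht
      rw [← one_div, le_div_iff₀ (by positivity), mul_comm]
      exact ht.le
  have hP := Real.tsum_eq_tsum_fourier_of_rpow_decay_of_summable hcont one_lt_two hO hsum' 0
  simp only [zero_add, QuotientAddGroup.mk_zero, fourier_eval_zero, mul_one] at hP
  have hL : ∑' n : ℤ, g n = ∑' n : ℕ+, ((n : ℕ) : ℂ) ^ (s - 1) *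
      Complex.exp (2 * Real.pi * Complex.I * ((n : ℕ) : ℂ) * w) := by
    have hinj : Function.Injective fun n : ℕ+ => ((n : ℕ) : ℤ) :=
      Nat.cast_injective.comp PNat.coe_injective
    rw [← hinj.tsum_eq]
    · refine tsum_congr fun n => ?_
      rw [hgpos _ (by exact_mod_cast n.pos)]
      simp only [ρ]
      push_cast
      congr 2
      ring
    · intro n hn
      have hn₀ : 0 < n := by
        by_contra h
        exact hn (hg₀ _ (by exact_mod_cast not_lt.1 h))
      exact ⟨⟨n.toNat, by omega⟩, by simp [hn₀.le]⟩
  rw [← hL, hP, tsum_congr hF', tsum_mul_left,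
    ← (Equiv.neg ℤ).tsum_eq fun k : ℤ => 1 / (w + k) ^ s]
  simp only [Equiv.neg_apply]
  field_simp

/-! ### The Fourier series: majorant and geometric expansion -/

theorem norm_exp_two_pi_I_mul (n : ℕ) (τ : ℂ) :
    ‖Complex.exp (2 * Real.pi * Complex.I * (n : ℂ) * τ)‖
      = Real.exp (-(2 * Real.pi * τ.im)) ^ n := by
  rw [Complex.norm_exp, ← Real.exp_nat_mul]
  congr 1
  simp
  ring

theorem exp_neg_two_pi_mul_lt_one {y : ℝ} (hy : 0 < y) : Real.exp (-(2 * Real.pi * y)) < 1 :=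
  Real.exp_lt_one_iff.2 (neg_neg_of_pos (by have := Real.pi_pos; positivity))

theorem norm_exp_two_pi_I_mul_lt_one (n : ℕ+) {τ : ℂ} (hτ : 0 < τ.im) :
    ‖Complex.exp (2 * Real.pi * Complex.I * ((n : ℕ) : ℂ) * τ)‖ < 1 := by
  rw [norm_exp_two_pi_I_mul]
  exact pow_lt_one₀ (Real.exp_pos _).le (exp_neg_two_pi_mul_lt_one hτ) n.ne_zero

/-- A majorant of the terms of the Fourier series, uniform on the half-plane `Re s ≤ K + 1`. -/
noncomputable def fourierMajorant {r : ℕ} (K : ℕ) (z : ℂ) (ω : Fin r → ℂ) (n : ℕ+) : ℝ :=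
  (n : ℕ) ^ K * Real.exp (-(2 * Real.pi * z.im)) ^ (n : ℕ) *
    ∏ j, (1 - Real.exp (-(2 * Real.pi * (ω j).im)))⁻¹

theorem summable_fourierMajorant {r : ℕ} (K : ℕ) {z : ℂ} (hz : 0 < z.im) (ω : Fin r → ℂ) :
    Summable (fourierMajorant K z ω) := by
  have h := summable_pow_mul_geometric_of_norm_lt_one K
    (r := Real.exp (-(2 * Real.pi * z.im)))
    (by rw [Real.norm_of_nonneg (Real.exp_pos _).le]; exact exp_neg_two_pi_mul_lt_one hz)
  exact (h.comp_injective PNat.coe_injective).mul_right _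

/-- The left side is the sum of the norms over `m` in the expanded double series, so this one bound
serves both the Fourier terms and the exchange of sums. -/
theorem norm_mul_prod_le_fourierMajorant {r K : ℕ} {s : ℂ} (hs : s.re ≤ K + 1) (z : ℂ)
    {ω : Fin r → ℂ} (hω : ∀ j, 0 < (ω j).im) (n : ℕ+) :
    ‖((n : ℕ) : ℂ) ^ (s - 1) * Complex.exp (2 * Real.pi * Complex.I * ((n : ℕ) : ℂ) * z)‖ *
      ∏ j, (1 - ‖Complex.exp (2 * Real.pi * Complex.I * ((n : ℕ) : ℂ) * ω j)‖)⁻¹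
        ≤ fourierMajorant K z ω n := by
  have hn : (1 : ℝ) ≤ (n : ℕ) := by exact_mod_cast n.pos
  have h₁ : ∀ j, 0 < (1 - ‖Complex.exp (2 * Real.pi * Complex.I * ((n : ℕ) : ℂ) * ω j)‖)⁻¹ :=
    fun j => inv_pos.2 (sub_pos.2 (norm_exp_two_pi_I_mul_lt_one n (hω j)))
  rw [norm_mul, Complex.norm_natCast_cpow_of_pos n.pos, norm_exp_two_pi_I_mul, fourierMajorant]
  refine mul_le_mul ?_ (Finset.prod_le_prod (fun j _ => (h₁ j).le) fun j _ => ?_)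
    (Finset.prod_nonneg fun j _ => (h₁ j).le) (by positivity)
  · gcongr
    rw [← Real.rpow_natCast]
    exact Real.rpow_le_rpow_of_exponent_le hn (by simpa using hs)
  · have h₂ := exp_neg_two_pi_mul_lt_one (hω j)
    rw [norm_exp_two_pi_I_mul]
    refine inv_anti₀ (sub_pos.2 h₂) (sub_le_sub_left ?_ _)
    exact pow_le_of_le_one (Real.exp_pos _).le h₂.le n.ne_zero

theorem norm_fourierTerm_le {r K : ℕ} {s : ℂ} (hs : s.re ≤ K + 1) (z : ℂ)
    {ω : Fin r → ℂ} (hω : ∀ j, 0 < (ω j).im) (n : ℕ+) :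
    ‖fourierTerm s z ω n‖ ≤ fourierMajorant K z ω n := by
  refine le_trans ?_ (norm_mul_prod_le_fourierMajorant hs z hω n)
  rw [fourierTerm, norm_div, div_eq_mul_inv, norm_prod, ← Finset.prod_inv_distrib]
  gcongr with j
  · exact sub_pos.2 (norm_exp_two_pi_I_mul_lt_one n (hω j))
  · simpa using norm_sub_norm_le 1
      (Complex.exp (2 * Real.pi * Complex.I * ((n : ℕ) : ℂ) * ω j))

theorem summable_fourierTerm {r : ℕ} (s : ℂ) {z : ℂ} (hz : 0 < z.im) {ω : Fin r → ℂ}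
    (hω : ∀ j, 0 < (ω j).im) : Summable (fourierTerm s z ω) := by
  obtain ⟨K, hK⟩ := exists_nat_ge s.re
  exact Summable.of_norm_bounded (summable_fourierMajorant K hz ω)
    (norm_fourierTerm_le (by linarith) z hω)

theorem differentiable_tsum_fourierTerm {r : ℕ} {z : ℂ} (hz : 0 < z.im) {ω : Fin r → ℂ}
    (hω : ∀ j, 0 < (ω j).im) : Differentiable ℂ fun s => ∑' n : ℕ+, fourierTerm s z ω n := by
  intro s
  obtain ⟨K, hK⟩ := exists_nat_ge s.re
  have hU : IsOpen {s : ℂ | s.re < K + 1} := isOpen_lt Complex.continuous_re continuous_const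
  have h := Complex.differentiableOn_tsum_of_summable_norm
    (F := fun (n : ℕ+) s => fourierTerm s z ω n) (summable_fourierMajorant K hz ω)
    (fun n => ?_) hU fun n q hq => norm_fourierTerm_le (le_of_lt hq) z hω n
  · exact h.differentiableAt (hU.mem_nhds (by simp; linarith))
  · unfold fourierTerm
    have hn : ((n : ℕ) : ℂ) ≠ 0 := by exact_mod_cast n.ne_zero
    exact (((by fun_prop : Differentiable ℂ fun s : ℂ => s - 1).const_cpow (Or.inl hn)).mul_const
      _).div_const _ |>.differentiableOn

theorem hasSum_prod_exp {r : ℕ} {ω : Fin r → ℂ} (hω : ∀ j, 0 < (ω j).im) (s z : ℂ) (n : ℕ+) :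
    HasSum (fun m : Fin r → ℕ => ((n : ℕ) : ℂ) ^ (s - 1) *
        Complex.exp (2 * Real.pi * Complex.I * ((n : ℕ) : ℂ) * (z + ∑ j, (m j : ℂ) * ω j)))
      (fourierTerm s z ω n) ∧
    HasSum (fun m : Fin r → ℕ => ‖((n : ℕ) : ℂ) ^ (s - 1) *
        Complex.exp (2 * Real.pi * Complex.I * ((n : ℕ) : ℂ) * (z + ∑ j, (m j : ℂ) * ω j))‖)
      (‖((n : ℕ) : ℂ) ^ (s - 1) *
        Complex.exp (2 * Real.pi * Complex.I * ((n : ℕ) : ℂ) * z)‖ *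
      ∏ j, (1 - ‖Complex.exp (2 * Real.pi * Complex.I * ((n : ℕ) : ℂ) * ω j)‖)⁻¹) := by
  set q : Fin r → ℂ := fun j => Complex.exp (2 * Real.pi * Complex.I * ((n : ℕ) : ℂ) * ω j)
  have hq : ∀ j, ‖q j‖ < 1 := fun j => norm_exp_two_pi_I_mul_lt_one n (hω j)
  have hterm : ∀ m : Fin r → ℕ, ((n : ℕ) : ℂ) ^ (s - 1) *
        Complex.exp (2 * Real.pi * Complex.I * ((n : ℕ) : ℂ) * (z + ∑ j, (m j : ℂ) * ω j)) =
      (((n : ℕ) : ℂ) ^ (s - 1) * Complex.exp (2 * Real.pi * Complex.I * ((n : ℕ) : ℂ) * z)) *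
        ∏ j, q j ^ m j := fun m => by
    simp only [q, ← Complex.exp_nat_mul]
    rw [← Complex.exp_sum, mul_assoc _ (Complex.exp _), ← Complex.exp_add, mul_add, Finset.mul_sum]
    congr 3
    exact Finset.sum_congr rfl fun j _ => by ring
  have hnorm : ∀ j, Summable fun k : ℕ => ‖‖q j‖ ^ k‖ := fun j => by
    simpa using summable_geometric_of_lt_one (norm_nonneg _) (hq j)
  have h₁ := (summable_norm_and_hasSum_prod_fin (fun j (k : ℕ) => q j ^ k)
    fun j => by simpa using hnorm j).2
  have h₂ := (summable_norm_and_hasSum_prod_fin (fun j (k : ℕ) => ‖q j‖ ^ k) hnorm).2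
  simp only [tsum_geometric_of_norm_lt_one (hq _)] at h₁
  simp only [tsum_geometric_of_lt_one (norm_nonneg _) (hq _)] at h₂
  simp only [hterm, norm_mul _ (∏ j, q j ^ _), norm_prod, norm_pow]
  refine ⟨?_, h₂.mul_left _⟩
  rw [fourierTerm, div_eq_mul_inv, ← Finset.prod_inv_distrib]
  exact h₁.mul_left _

theorem tsum_tsum_exp_eq_tsum_fourierTerm {r : ℕ} (s : ℂ) {z : ℂ} (hz : 0 < z.im)
    {ω : Fin r → ℂ} (hω : ∀ j, 0 < (ω j).im) :
    ∑' m : Fin r → ℕ, ∑' n : ℕ+, ((n : ℕ) : ℂ) ^ (s - 1) *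
        Complex.exp (2 * Real.pi * Complex.I * ((n : ℕ) : ℂ) * (z + ∑ j, (m j : ℂ) * ω j)) =
      ∑' n : ℕ+, fourierTerm s z ω n := by
  obtain ⟨K, hK⟩ := exists_nat_ge s.re
  rw [Summable.tsum_comm]
  · exact tsum_congr fun n => (hasSum_prod_exp hω s z n).1.tsum_eq
  · refine Summable.of_norm ((summable_prod_of_nonneg fun _ => norm_nonneg _).2
      ⟨fun n => (hasSum_prod_exp hω s z n).2.summable, ?_⟩)
    refine Summable.of_nonneg_of_le (fun n => tsum_nonneg fun _ => norm_nonneg _) (fun n => ?_)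
      (summable_fourierMajorant K hz ω)
    exact (hasSum_prod_exp hω s z n).2.tsum_eq.trans_le
      (norm_mul_prod_le_fourierMajorant (by linarith) z hω n)

/-! ### From the Barnes pair to the Fourier series -/

/-- The Barnes series with one parameter singled out, as an iterated series. -/
theorem summable_and_barnesZeta_cons {r : ℕ} {s x a : ℂ} {ω : Fin r → ℂ}
    (h : Summable (barnesTerm s x (Fin.cons a ω : Fin (r + 1) → ℂ))) :
    (∀ m : Fin r → ℕ, Summable fun k : ℕ => 1 / (x + k * a + ∑ j, (m j : ℂ) * ω j) ^ s) ∧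
    HasSum (fun m : Fin r → ℕ => ∑' k : ℕ, 1 / (x + k * a + ∑ j, (m j : ℂ) * ω j) ^ s)
      (barnesZeta s x (Fin.cons a ω : Fin (r + 1) → ℂ)) := by
  set e := (Equiv.prodComm (Fin r → ℕ) ℕ).trans (Fin.consEquiv fun _ : Fin (r + 1) => ℕ)
  have he : ∀ p : (Fin r → ℕ) × ℕ, barnesTerm s x (Fin.cons a ω : Fin (r + 1) → ℂ) (e p) =
      1 / (x + p.2 * a + ∑ j, (p.1 j : ℂ) * ω j) ^ s := fun p => by
    simp [barnesTerm, e, Fin.consEquiv, Fin.sum_univ_succ, add_assoc]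
  have h₁ := e.hasSum_iff.2 h.hasSum
  rw [show barnesTerm s x (Fin.cons a ω : Fin (r + 1) → ℂ) ∘ e =
    fun p => 1 / (x + p.2 * a + ∑ j, (p.1 j : ℂ) * ω j) ^ s from funext he] at h₁
  have h₂ := h₁.summable.prod_factor
  exact ⟨h₂, h₁.prod_fiberwise fun m => (h₂ m).hasSum⟩

theorem summable_barnesTerm_pair {r : ℕ} {s z : ℂ} (hz : 0 < z.im) {ω : Fin r → ℂ}
    (hω : ∀ j, 0 < (ω j).im) (hs : (r : ℝ) + 1 < s.re) :
    Summable (barnesTerm s (z + Complex.exp (Real.pi * Complex.I))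
      (Fin.cons (Complex.exp (Real.pi * Complex.I)) ω : Fin (r + 1) → ℂ)) ∧
    Summable (barnesTerm s z
      (Fin.cons (-Complex.exp (Real.pi * Complex.I)) ω : Fin (r + 1) → ℂ)) := by
  rw [Complex.exp_pi_mul_I, neg_neg]
  constructor
  · simpa using summable_barnesTerm_cons_ofReal (x := z + -1) (a := -1) (by norm_num) hs
      (by simpa using hz) hω
  · simpa using summable_barnesTerm_cons_ofReal (a := 1) one_ne_zero hs hz hω

/-- The Fourier expansion of the bilateral zeta function in the domain of absolute convergence. -/
theorem bilateralZetaSum_eq_tsum_fourierTerm {r : ℕ} {s z : ℂ} (hz : 0 < z.im) {ω : Fin r → ℂ}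
    (hω : ∀ j, 0 < (ω j).im) (hs : (r : ℝ) + 1 < s.re) :
    bilateralZetaSum s z (Complex.exp (Real.pi * Complex.I)) ω =
      Complex.exp (-(Real.pi / 2) * Complex.I * s) * (2 * Real.pi : ℂ) ^ s / Complex.Gamma s *
        ∑' n : ℕ+, fourierTerm s z ω n := by
  have hs₁ : 1 < s.re := by have : (0 : ℝ) ≤ r := Nat.cast_nonneg r; linarith
  obtain ⟨h₁, h₂⟩ := summable_barnesTerm_pair hz hω hs
  obtain ⟨h₁, h₁'⟩ := summable_and_barnesZeta_cons h₁
  obtain ⟨h₂, h₂'⟩ := summable_and_barnesZeta_cons h₂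
  rw [bilateralZetaSum, ← (h₁'.add h₂').tsum_eq, ← tsum_tsum_exp_eq_tsum_fourierTerm s hz hω,
    ← tsum_mul_left]
  refine tsum_congr fun m => ?_
  have him : 0 < (z + ∑ j, (m j : ℂ) * ω j).im := by
    rw [Complex.add_im, Complex.im_sum]
    refine add_pos_of_pos_of_nonneg hz (Finset.sum_nonneg fun j _ => ?_)
    rw [← Complex.ofReal_natCast, Complex.im_ofReal_mul]
    exact mul_nonneg (Nat.cast_nonneg _) (hω j).le
  -- The shift by e^(πi) starts this half at -1, so 0 is not counted twice.
  have e₁ : ∀ k : ℕ, z + Complex.exp (Real.pi * Complex.I) +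
      k * Complex.exp (Real.pi * Complex.I) + ∑ j, (m j : ℂ) * ω j =
        z + ∑ j, (m j : ℂ) * ω j + ((-((k : ℤ) + 1) : ℤ) : ℂ) := fun k => by
    rw [Complex.exp_pi_mul_I]; push_cast; ring
  have e₂ : ∀ k : ℕ, z + k * -Complex.exp (Real.pi * Complex.I) + ∑ j, (m j : ℂ) * ω j =
      z + ∑ j, (m j : ℂ) * ω j + ((k : ℤ) : ℂ) := fun k => by
    rw [Complex.exp_pi_mul_I]; push_cast; ring
  have h₁m := h₁ m
  have h₂m := h₂ m
  simp only [e₁] at h₁m ⊢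
  simp only [e₂] at h₂m ⊢
  rw [← tsum_int_one_div_add_cpow him hs₁, add_comm]
  exact (tsum_of_nat_of_neg_add_one
    (f := fun k : ℤ => 1 / (z + ∑ j, (m j : ℂ) * ω j + (k : ℂ)) ^ s) h₂m h₁m).symm

/-! ### Analytic continuation -/

/-- By the identity theorem the chosen extension equals `F`, as both agree near σ + 1. -/
theorem entireContinuation_eq {σ : ℝ} {f F : ℂ → ℂ} (hF : Differentiable ℂ F)
    (hFf : ∀ s : ℂ, σ < s.re → F s = f s) : entireContinuation σ f = F := by
  have hex : ∃ F : ℂ → ℂ, Differentiable ℂ F ∧ ∀ s : ℂ, σ < s.re → F s = f s := ⟨F, hF, hFf⟩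
  rw [entireContinuation, dif_pos hex]
  obtain ⟨hG, hGf⟩ := hex.choose_spec
  refine (hG.differentiableOn.analyticOnNhd isOpen_univ).eq_of_eventuallyEq
    (hF.differentiableOn.analyticOnNhd isOpen_univ) (z₀ := ((σ + 1 : ℝ) : ℂ)) ?_
  filter_upwards [(isOpen_lt continuous_const Complex.continuous_re).mem_nhds
    (show σ < (((σ + 1 : ℝ) : ℂ)).re by simp)] with s hs
  rw [hGf s hs, hFf s hs]

end

/-- At `s = 0, -1, -2, …` the factor `1 / Γ(s)` has to be read as `0`; this is also the value of the
division by `Complex.Gamma s = 0` below. -/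
theorem theorem4p7 (r : ℕ) (z : ℂ) (hz : 0 < z.im) (ω : Fin r → ℂ) (hω : ∀ j, 0 < (ω j).im) :
    (∀ s : ℂ, (r : ℝ) + 1 < s.re →
      Summable (barnesTerm s (z + Complex.exp (Real.pi * Complex.I))
        (Fin.cons (Complex.exp (Real.pi * Complex.I)) ω : Fin (r + 1) → ℂ)) ∧
      Summable (barnesTerm s z
        (Fin.cons (-Complex.exp (Real.pi * Complex.I)) ω : Fin (r + 1) → ℂ)) ∧
      bilateralZeta s z (Complex.exp (Real.pi * Complex.I)) ω =
        bilateralZetaSum s z (Complex.exp (Real.pi * Complex.I)) ω) ∧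
    Differentiable ℂ (fun s : ℂ => bilateralZeta s z (Complex.exp (Real.pi * Complex.I)) ω) ∧
    ∀ s : ℂ,
      Summable (fourierTerm s z ω) ∧
      bilateralZeta s z (Complex.exp (Real.pi * Complex.I)) ω =
        Complex.exp (-(Real.pi / 2) * Complex.I * s) * (2 * Real.pi : ℂ) ^ s / Complex.Gamma s *
          ∑' n : ℕ+, fourierTerm s z ω n := by
  set F : ℂ → ℂ := fun s =>
    Complex.exp (-(Real.pi / 2) * Complex.I * s) * (2 * Real.pi : ℂ) ^ s / Complex.Gamma s *
      ∑' n : ℕ+, fourierTerm s z ω n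
  have hπ : (2 * Real.pi : ℂ) ≠ 0 := by simp [Real.pi_ne_zero]
  have hF : Differentiable ℂ F := by
    -- The inverse of `Complex.Gamma`, with value 0 at the poles, is entire.
    simp only [F, div_eq_mul_inv]
    exact (((by fun_prop : Differentiable ℂ fun s : ℂ =>
      Complex.exp (-(Real.pi * 2⁻¹) * Complex.I * s)).mul
        (differentiable_id.const_cpow (Or.inl hπ))).mul
          Complex.differentiable_one_div_Gamma).mul (differentiable_tsum_fourierTerm hz hω)
  have hFξ : ∀ s : ℂ, (r : ℝ) + 1 < s.re →
      F s = bilateralZetaSum s z (Complex.exp (Real.pi * Complex.I)) ω := fun s hs =>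
    (bilateralZetaSum_eq_tsum_fourierTerm hz hω hs).symm
  have hξ : ∀ s, bilateralZeta s z (Complex.exp (Real.pi * Complex.I)) ω = F s := fun s =>
    congrFun (entireContinuation_eq hF hFξ) s
  refine ⟨fun s hs => ?_, ?_, fun s => ⟨summable_fourierTerm s hz hω, hξ s⟩⟩
  · obtain ⟨h₁, h₂⟩ := summable_barnesTerm_pair hz hω hs
    exact ⟨h₁, h₂, (hξ s).trans (hFξ s hs)⟩
  · simpa only [hξ] using hF
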